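/- Let $X$ be a Polish space whose topology is given by a metric, with its Borel $\sigma$-field, and call a set bounded if it is bounded for this metric. A point measure on $X$ is a measure taking values in $\{0,1,2,\dots\}$ on bounded Borel sets; the space $\mathcal M^{\cdot\cdot}(X)$ of point measures carries the vague topology and the $\sigma$-field generated by the evaluations $\mu\mapsto\mu(B)$. A point process with Papangelou kernel $\pi$ is a probability measure $Q$ on $\mathcal M^{\cdot\cdot}(X)$ with $$\iint h(x,\mu)\,\mu(dx)\,Q(d\mu)=\iint h(x,\mu+\delta_x)\,\pi(\mu,dx)\,Q(d\mu)$$ for all measurable $h\ge 0$. The Poisson process with intensity measure $\rho$ is the one with $\pi(\mu,\cdot)=\rho$, and the Pólya sum process $S_{z,\rho}$, $z\in(0,1)$, is the one with $\pi(\mu,\cdot)=z(\rho+\mu)$. Let $\rho$ be a diffuse measure on $X$ that is finite on bounded Borel sets, and let $(Y_t)_{t\in[0,1)}$ be the spatial Chinese restaurant-like process with parameter $\rho$: a Markov process in $\mathcal M^{\cdot\cdot}(X)$ with increasing càdlàg paths, with $Y_0=0$ almost surely, and such that for $0\le s<t<1$ the conditional law of $Y_t$ given $(Y_r)_{r\le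 s}$ is that of $Y_s+\mu$ where $\mu$ has law $S_{\frac{t-s}{1-s},\,\rho+Y_s}$. Let $t\in[0,1)$ and let $B\subseteq X$ be a bounded Borel set. Let $U_{B,t}$ be the random measure on $\mathbb N=\{1,2,\dots\}$ whose weight at $j$ is the number of points of $Y_t$ in $B$ of multiplicity $j$, that is, $U_{B,t}(\{j\})=\#\{x\in B: Y_t(\{x\})=j\}$. Then $U_{B,t}$ is a finite Poisson process on $\mathbb N$ with the finite intensity measure $$\rho(B)\sum_{j\ge 1}\frac{t^j}{j}\,\delta_j .$$ In particular, the counts $U_{B,t}(\{j\})$, $j\ge 1$, are independent, and $U_{B,t}(\{j\})$ is Poisson distributed with mean $\rho(B)\,t^j/j$. -/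

import Mathlib

open MeasureTheory ProbabilityTheory Filter Topology Set
open scoped ENNReal NNReal

noncomputable section

/-- The positive integers carry the discrete σ-algebra. -/
instance PNat.discreteMeasurableSpace : MeasurableSpace ℕ+ := ⊤

instance PNat.instDiscreteMeasurableSpace : DiscreteMeasurableSpace ℕ+ := ⟨fun _ => trivial⟩

/-- A measure is locally finite if it is finite on bounded measurable sets. -/
def FiniteOnBounded {X : Type*} [Bornology X] [MeasurableSpace X] (ρ : Measure X) : Prop :=
  ∀ B : Set X, MeasurableSet B → Bornology.IsBounded B → ρ B < ∞

/-- The locally finite point measures on `X`: bounded measurable sets have masses in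
`{0, 1, 2, …}`. -/
def PointMeasure (X : Type*) [Bornology X] [MeasurableSpace X] : Type _ :=
  {μ : Measure X // ∀ B : Set X, MeasurableSet B → Bornology.IsBounded B → ∃ n : ℕ, μ B = n}

namespace PointMeasure

variable {X : Type*} [Bornology X] [MeasurableSpace X]

/-- The underlying measure of a point measure. -/
def toMeasure (μ : PointMeasure X) : Measure X := μ.1

/-- The σ-algebra generated by the evaluations `μ ↦ μ B`. -/
instance : MeasurableSpace (PointMeasure X) :=
  MeasurableSpace.comap toMeasure inferInstance

/-- `μ ≤ ν` if this holds on every measurable set. -/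
instance : PartialOrder (PointMeasure X) := PartialOrder.lift toMeasure Subtype.val_injective

/-- The vague topology: the coarsest one for which `μ ↦ ∫ f dμ` is continuous for every
non-negative bounded continuous function `f` with bounded support. -/
instance [TopologicalSpace X] : TopologicalSpace (PointMeasure X) :=
  ⨅ f : {f : BoundedContinuousFunction X ℝ≥0 // Bornology.IsBounded (Function.support f)},
    TopologicalSpace.induced (fun μ : PointMeasure X => ∫⁻ x, (f.1 x : ℝ≥0∞) ∂μ.toMeasure)
      inferInstance

/-- The empty configuration. -/
instance : Zero (PointMeasure X) := ⟨⟨0, fun _ _ _ => ⟨0, by simp⟩⟩⟩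

/-- Superposition of configurations. -/
instance : Add (PointMeasure X) :=
  ⟨fun μ ν => ⟨μ.1 + ν.1, fun B hB hb => by
    obtain ⟨m, hm⟩ := μ.2 B hB hb
    obtain ⟨n, hn⟩ := ν.2 B hB hb
    exact ⟨m + n, by simp [hm, hn]⟩⟩⟩

/-- The configuration consisting of one point at `x`. -/
def single (x : X) : PointMeasure X :=
  ⟨Measure.dirac x, fun B hB _ => by
    by_cases hx : x ∈ B
    · exact ⟨1, by simp [Measure.dirac_apply' x hB, hx]⟩
    · exact ⟨0, by simp [Measure.dirac_apply' x hB, hx]⟩⟩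

end PointMeasure

/-- `Q` is the law of a point process on `X` with Papangelou kernel `π`:
`∬ h(x, μ) μ(dx) Q(dμ) = ∬ h(x, μ + δ_x) π(μ, dx) Q(dμ)` for all measurable `h ≥ 0`. -/
structure IsPapangelouProcess {X : Type*} [Bornology X] [MeasurableSpace X]
    (π : PointMeasure X → Measure X) (Q : Measure (PointMeasure X)) : Prop where
  isProbabilityMeasure : IsProbabilityMeasure Q
  campbell : ∀ h : X → PointMeasure X → ℝ≥0∞, Measurable (Function.uncurry h) →
    ∫⁻ μ, ∫⁻ x, h x μ ∂μ.toMeasure ∂Q =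
      ∫⁻ μ, ∫⁻ x, h x (μ + PointMeasure.single x) ∂(π μ) ∂Q

/-- `Q` is the law of the Poisson process with intensity measure `ρ`. -/
def IsPoissonProcess {X : Type*} [Bornology X] [MeasurableSpace X]
    (ρ : Measure X) (Q : Measure (PointMeasure X)) : Prop :=
  IsPapangelouProcess (fun _ => ρ) Q

/-- `Q` is the law of the Pólya sum process with parameters `z` and `ρ`, whose Papangelou kernel
is `z (ρ + μ)`. -/
def IsPolyaSumProcess {X : Type*} [Bornology X] [MeasurableSpace X]
    (z : ℝ) (ρ : Measure X) (Q : Measure (PointMeasure X)) : Prop :=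
  IsPapangelouProcess (fun μ => ENNReal.ofReal z • (ρ + μ.toMeasure)) Q

/-- `p` is the transition kernel from time `s` to time `t`: under `p ν` the configuration is
`ν` plus a Pólya sum process with parameters `(t - s) / (1 - s)` and `ρ + ν`. -/
def IsPolyaTransition {X : Type*} [Bornology X] [MeasurableSpace X] (ρ : Measure X) (s t : ℝ)
    (p : Kernel (PointMeasure X) (PointMeasure X)) : Prop :=
  ∀ ν : PointMeasure X, ∃ Q : Measure (PointMeasure X),
    IsPolyaSumProcess ((t - s) / (1 - s)) (ρ + ν.toMeasure) Q ∧ p ν = Q.map (fun μ => ν + μ)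

/-- `Y` is the spatial Chinese restaurant-like process with parameter measure `ρ`: the Markov
process with increasing càdlàg paths in the space of locally finite point measures (with the vague
topology), indexed by `[0,1)`, started in the empty configuration, with the above transition
kernels. -/
structure IsSpatialRestaurantProcess {X Ω : Type*} [MetricSpace X] [MeasurableSpace X]
    [MeasurableSpace Ω] (ρ : Measure X) (P : Measure Ω)
    (Y : Ico (0 : ℝ) 1 → Ω → PointMeasure X) : Prop where
  measurable : ∀ t, Measurable (Y t)
  monotone : ∀ ω, Monotone fun t => Y t ω
  rightContinuous : ∀ ω t, ContinuousWithinAt (fun s => Y s ω) (Ici t) t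
  leftLimit : ∀ ω t, ∃ l : PointMeasure X, Tendsto (fun s => Y s ω) (𝓝[<] t) (𝓝 l)
  init : ∀ᵐ ω ∂P, Y ⟨0, by simp⟩ ω = 0
  markov : ∀ s t : Ico (0 : ℝ) 1, s < t →
    ∃ p : Kernel (PointMeasure X) (PointMeasure X), IsPolyaTransition ρ s t p ∧
      ∀ A : Set Ω, MeasurableSet[⨆ r ≤ s, MeasurableSpace.comap (Y r) inferInstance] A →
        ∀ C : Set (PointMeasure X), MeasurableSet C →
          P (A ∩ Y t ⁻¹' C) = ∫⁻ ω in A, p (Y s ω) C ∂P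

/-- A point measure has finitely many atoms of a given multiplicity in a bounded set. -/
theorem PointMeasure.finite_multiplicity {X : Type*} [Bornology X] [MeasurableSpace X]
    [MeasurableSingletonClass X] {B : Set X} (hB : MeasurableSet B)
    (hb : Bornology.IsBounded B) (μ : PointMeasure X) (j : ℕ+) :
    {x ∈ B | μ.toMeasure {x} = (j : ℕ)}.Finite := by
  obtain ⟨n, hn⟩ := μ.2 B hB hb
  have hfin : (μ.toMeasure.restrict B) univ ≠ ∞ := by
    rw [Measure.restrict_apply_univ]
    change μ.1 B ≠ ∞
    simp [hn]
  have key := Measure.finite_const_le_meas_of_disjoint_iUnion (μ.toMeasure.restrict B)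
    (ε := 1) one_pos (As := fun x : X => ({x} : Set X)) (fun x => measurableSet_singleton x)
    (fun x y hxy => by simpa using hxy) (ne_top_of_le_ne_top hfin (measure_mono (subset_univ _)))
  refine key.subset fun x hx => ?_
  have h1 : ((1 : ℕ) : ℝ≥0∞) ≤ ((j : ℕ) : ℝ≥0∞) := Nat.cast_le.2 (one_le : 1 ≤ j)
  have hxB : ({x} : Set X) ∩ B = {x} := inter_eq_left.2 (singleton_subset_iff.2 hx.1)
  change 1 ≤ (μ.toMeasure.restrict B) {x}
  rw [Measure.restrict_apply (measurableSet_singleton x), hxB, hx.2]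
  exact_mod_cast h1

/-- The point measure `U_B(μ)` on the positive integers whose weight at `j` is the number of points
of `μ` in the bounded set `B` of multiplicity `j`, that is, of `x ∈ B` with `μ {x} = j`. -/
def multiplicityMeasure {X : Type*} [Bornology X] [MeasurableSpace X] [MeasurableSingletonClass X]
    {B : Set X} (hB : MeasurableSet B) (hb : Bornology.IsBounded B) (μ : PointMeasure X) :
    PointMeasure ℕ+ :=
  ⟨Measure.sum fun j : ℕ+ =>
      (({x ∈ B | μ.toMeasure {x} = (j : ℕ)}.encard : ℕ∞) : ℝ≥0∞) • Measure.dirac j, by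
    classical
    intro A hm hA
    have hAf : A.Finite :=
      (Metric.isCompact_of_isClosed_isBounded (isClosed_discrete A) hA).finite_of_discrete
    refine ⟨∑ j ∈ hAf.toFinset, {x ∈ B | μ.toMeasure {x} = (j : ℕ)}.ncard, ?_⟩
    rw [Measure.sum_apply _ hm, tsum_eq_sum (s := hAf.toFinset)]
    · rw [Nat.cast_sum]
      refine Finset.sum_congr rfl fun j hj => ?_
      have hjA : j ∈ A := hAf.mem_toFinset.1 hj
      rw [Measure.smul_apply, Measure.dirac_apply' _ hm, indicator_of_mem hjA,
        ← (PointMeasure.finite_multiplicity hB hb μ j).cast_ncard_eq]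
      simp
    · intro j hj
      have hjA : j ∉ A := fun h => hj (hAf.mem_toFinset.2 h)
      rw [Measure.smul_apply, Measure.dirac_apply' _ hm, indicator_of_notMem hjA]
      simp⟩

/-- The measure `c ∑_{j ≥ 1} (t ^ j / j) δ_j` on the positive integers. -/
def logarithmicIntensity (c : ℝ≥0∞) (t : ℝ) : Measure ℕ+ :=
  c • Measure.sum fun j : ℕ+ => ENNReal.ofReal (t ^ (j : ℕ) / (j : ℕ)) • Measure.dirac j

end

/-! Since `Y` starts empty, the Markov property from time 0 shows that `Y t` has the Pólya sum law
with parameters `t` and `ρ`, so only this marginal matters.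

Write `z` for `t`. In the Campbell identity with kernel `z (ρ + μ)`, adding a point at `x` raises
the multiplicity of `x` by one. An integral over sites of multiplicity `k + 1` thus becomes `z`
times a `ρ`-integral plus a `μ`-integral, both over sites of multiplicity `k`. Diffuse `ρ` sees only
multiplicity 0, whereas `μ`, being purely atomic, does not charge it. Exactly one term survives each
time, and `j` iterations turn the integral over sites of multiplicity `j` into `z ^ j` times a
`ρ`-integral over `B` in which `j` points are placed at an unoccupied site
(`IsPolyaSumProcess.lintegral_multiplicitySet`).

In terms of `U_B`, such a placement adds one point at `j`, and the `μ`-mass of the sites of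
multiplicity `j` is `j` times their number. Dividing by `j` yields the Mecke equation with intensity
`ρ B * z ^ j / j`, which defines the Poisson process. Tested on events unaffected by the points at
`j`, it becomes the Stein recursion, giving Poisson counts and their independence. -/

namespace PointMeasure

/-! ### Point measures: evaluations, added points, the tautological kernel -/

section Basic

variable {X : Type*} [Bornology X] [MeasurableSpace X]

@[ext]
theorem ext {μ ν : PointMeasure X}
    (h : ∀ A, MeasurableSet A → μ.toMeasure A = ν.toMeasure A) : μ = ν :=
  Subtype.ext (Measure.ext h)

@[simp]
theorem toMeasure_zero : (0 : PointMeasure X).toMeasure = 0 := rfl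

@[simp]
theorem toMeasure_add (μ ν : PointMeasure X) :
    (μ + ν).toMeasure = μ.toMeasure + ν.toMeasure := rfl

@[simp]
theorem toMeasure_single (x : X) : (single x).toMeasure = Measure.dirac x := rfl

theorem measurable_toMeasure : Measurable (toMeasure : PointMeasure X → Measure X) :=
  comap_measurable _

theorem measurable_coe {A : Set X} (hA : MeasurableSet A) :
    Measurable fun μ : PointMeasure X => μ.toMeasure A :=
  (Measure.measurable_coe hA).comp measurable_toMeasure

theorem measurable_of_measurable_coe {α : Type*} [MeasurableSpace α] {f : α → PointMeasure X}
    (h : ∀ A, MeasurableSet A → Measurable fun a => (f a).toMeasure A) : Measurable f :=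
  measurable_comap_iff.2 (Measure.measurable_of_measurable_coe _ h)

theorem measurable_add_single :
    Measurable fun p : X × PointMeasure X => p.2 + single p.1 := by
  refine measurable_of_measurable_coe fun A hA => ?_
  simp only [toMeasure_add, toMeasure_single, Measure.coe_add, Pi.add_apply,
    Measure.dirac_apply' _ hA]
  exact ((measurable_coe hA).comp measurable_snd).add
    ((measurable_one.indicator hA).comp measurable_fst)

/-- The configuration `μ` with `j` further points at `x`. -/
noncomputable def addSingle (μ : PointMeasure X) (x : X) (j : ℕ) : PointMeasure X :=
  (fun ν => ν + single x)^[j] μ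

theorem toMeasure_addSingle (μ : PointMeasure X) (x : X) (j : ℕ) :
    (addSingle μ x j).toMeasure = μ.toMeasure + j • Measure.dirac x := by
  induction j generalizing μ with
  | zero => simp [addSingle]
  | succ j ih =>
    change (addSingle (μ + single x) x j).toMeasure = _
    rw [ih, toMeasure_add, toMeasure_single, succ_nsmul, add_assoc,
      add_comm (Measure.dirac x)]

theorem exists_measure_eq_natCast (μ : PointMeasure X) {A : Set X} (hA : MeasurableSet A)
    (hb : Bornology.IsBounded A) : ∃ n : ℕ, μ.toMeasure A = n := μ.2 A hA hb

theorem measure_lt_top (μ : PointMeasure X) {A : Set X} (hA : MeasurableSet A)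
    (hb : Bornology.IsBounded A) : μ.toMeasure A < ∞ := by
  obtain ⟨n, hn⟩ := μ.exists_measure_eq_natCast hA hb
  simp [hn]

theorem exists_measure_singleton_eq_natCast [MeasurableSingletonClass X] (μ : PointMeasure X)
    (x : X) : ∃ n : ℕ, μ.toMeasure {x} = n :=
  μ.exists_measure_eq_natCast (measurableSet_singleton x) Bornology.isBounded_singleton

variable (X) in
/-- The kernel sending a configuration to its underlying measure. -/
noncomputable def kernel : Kernel (PointMeasure X) X := ⟨toMeasure, measurable_toMeasure⟩

@[simp]
theorem kernel_apply (μ : PointMeasure X) : kernel X μ = μ.toMeasure := rfl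

/-- The mass of `A` is finite but not bounded uniformly in `μ`. Cutting according to its integer
value gives countably many finite kernels. -/
theorem isSFiniteKernel_restrict_kernel {A : Set X} (hA : MeasurableSet A)
    (hb : Bornology.IsBounded A) : IsSFiniteKernel ((kernel X).restrict hA) := by
  classical
  have hS : ∀ k : ℕ, MeasurableSet {μ : PointMeasure X | μ.toMeasure A = k} := fun k =>
    measurable_coe hA (measurableSet_singleton _)
  have hfin : ∀ k : ℕ, IsFiniteKernel
      (Kernel.piecewise (hS k) ((kernel X).restrict hA) (0 : Kernel (PointMeasure X) X)) := by
    refine fun k => ⟨⟨k, ENNReal.natCast_lt_top k, fun μ => ?_⟩⟩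
    rw [Kernel.piecewise_apply]
    split_ifs with h
    · rw [Kernel.restrict_apply, Measure.restrict_apply_univ]
      exact le_of_eq h
    · simp
  have hsum : (kernel X).restrict hA = Kernel.sum fun k : ℕ =>
      Kernel.piecewise (hS k) ((kernel X).restrict hA) (0 : Kernel (PointMeasure X) X) := by
    ext μ C hC
    obtain ⟨n, hn⟩ := μ.exists_measure_eq_natCast hA hb
    rw [Kernel.sum_apply, Measure.sum_apply _ hC, tsum_eq_single n]
    · rw [Kernel.piecewise_apply, if_pos (by exact hn)]
    · intro k hk
      rw [Kernel.piecewise_apply, if_neg]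
      · simp
      · intro h
        exact hk (Nat.cast_injective (R := ℝ≥0∞) (h.symm.trans hn))
  rw [hsum]
  infer_instance

end Basic

/-! ### Point measures on metric spaces: s-finiteness and atomicity -/

section Metric

variable {X : Type*} [MetricSpace X] [MeasurableSpace X] [BorelSpace X]

/-- Countably many disjoint bounded shells around a point exhaust `X`. S-finiteness is what makes
integrals against the varying measure `μ` measurable in `μ`. -/
instance : IsSFiniteKernel (kernel X) := by
  rcases isEmpty_or_nonempty X with hX | ⟨⟨a⟩⟩
  · have h : kernel X = 0 := by
      ext μ A
      simp [Set.eq_empty_of_isEmpty A]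
    rw [h]
    infer_instance
  let D : ℕ → Set X := disjointed fun n : ℕ => Metric.closedBall a n
  have hD : ∀ n, MeasurableSet (D n) :=
    MeasurableSet.disjointed fun n => Metric.isClosed_closedBall.measurableSet
  have hDb : ∀ n, Bornology.IsBounded (D n) := fun n =>
    Metric.isBounded_closedBall.subset (disjointed_subset _ n)
  have hsum : kernel X = Kernel.sum fun n => (kernel X).restrict (hD n) := by
    ext μ C hC
    rw [Kernel.sum_apply, Measure.sum_apply _ hC]
    simp only [Kernel.restrict_apply]
    rw [← Measure.sum_apply _ hC, ← Measure.restrict_iUnion (disjoint_disjointed _) hD,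
      iUnion_disjointed, Metric.iUnion_closedBall_nat, Measure.restrict_univ]
  have := fun n => isSFiniteKernel_restrict_kernel (hD n) (hDb n)
  rw [hsum]
  infer_instance

theorem measurable_lintegral {h : X → PointMeasure X → ℝ≥0∞}
    (hh : Measurable (Function.uncurry h)) :
    Measurable fun μ : PointMeasure X => ∫⁻ x, h x μ ∂μ.toMeasure :=
  Measurable.lintegral_kernel_prod_right (κ := kernel X) (f := fun μ x => h x μ)
    (hh.comp measurable_swap)

variable [SecondCountableTopology X]

/-- The singleton is a section of the diagonal, which is measurable because `X` is second countable.
-/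
theorem measurable_measure_singleton :
    Measurable fun p : X × PointMeasure X => p.2.toMeasure {p.1} := by
  have hS : MeasurableSet {q : (X × PointMeasure X) × X | q.2 = q.1.1} :=
    measurableSet_eq_fun measurable_snd (measurable_fst.comp measurable_fst)
  exact Kernel.measurable_kernel_prodMk_left
    (κ := (kernel X).comap Prod.snd measurable_snd) hS

theorem measurableSet_multiplicity {B : Set X} (hB : MeasurableSet B) (μ : PointMeasure X)
    (c : ℝ≥0∞) : MeasurableSet {x ∈ B | μ.toMeasure {x} = c} :=
  hB.inter ((measurable_measure_singleton.comp measurable_prodMk_right)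
    (measurableSet_singleton c))

/-- A point measure is purely atomic. -/
theorem measure_multiplicity_zero {B : Set X} (hB : MeasurableSet B)
    (hb : Bornology.IsBounded B) (μ : PointMeasure X) :
    μ.toMeasure {x ∈ B | μ.toMeasure {x} = 0} = 0 := by
  -- By second countability it suffices that each point of the set has a null neighbourhood within
  -- it.
  refine measure_null_of_locally_null _ fun x hx => ?_
  have hlim := tendsto_measure_biInter_gt (μ := μ.toMeasure)
    (s := fun r : ℝ => B ∩ Metric.closedBall x r) (a := 0)
    (fun r _ => (hB.inter Metric.isClosed_closedBall.measurableSet).nullMeasurableSet)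
    (fun i j _ hij => inter_subset_inter_right _ (Metric.closedBall_subset_closedBall hij))
    ⟨1, one_pos, ((measure_mono inter_subset_left).trans_lt (μ.measure_lt_top hB hb)).ne⟩
  have hsub : ⋂ r > (0 : ℝ), B ∩ Metric.closedBall x r ⊆ {x} := by
    intro y hy
    simp only [mem_iInter, mem_inter_iff, Metric.mem_closedBall] at hy
    exact dist_le_zero.1 (le_of_forall_gt_imp_ge_of_dense fun r hr => (hy r hr).2)
  -- The masses of the shrinking balls in `B` tend to 0. Being integers, they vanish for some
  -- positive radius.
  rw [measure_mono_null hsub hx.2] at hlim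
  obtain ⟨r, hr, hr0⟩ := ((hlim.eventually (gt_mem_nhds one_pos)).and self_mem_nhdsWithin).exists
  obtain ⟨n, hn⟩ := μ.exists_measure_eq_natCast
    (hB.inter (Metric.isClosed_closedBall (x := x) (ε := r)).measurableSet)
    (hb.subset inter_subset_left)
  refine ⟨B ∩ Metric.closedBall x r, ?_, ?_⟩
  · exact inter_mem (mem_of_superset self_mem_nhdsWithin fun y hy => hy.1)
      (mem_nhdsWithin_of_mem_nhds (Metric.closedBall_mem_nhds x hr0))
  · have h1 : (n : ℝ≥0∞) < 1 := hn ▸ hr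
    rw [hn]
    have : n < 1 := by exact_mod_cast h1
    simp [Nat.lt_one_iff.1 this]

end Metric

theorem countable_measure_singleton_ne_zero {X : Type*} [Bornology X] [MeasurableSpace X]
    [MeasurableSingletonClass X] {B : Set X} (hB : MeasurableSet B) (hb : Bornology.IsBounded B)
    (μ : PointMeasure X) : {x ∈ B | μ.toMeasure {x} ≠ 0}.Countable := by
  refine (countable_iUnion fun j : ℕ+ => (finite_multiplicity hB hb μ j).countable).mono ?_
  rintro x ⟨hxB, hx⟩
  obtain ⟨n, hn⟩ := μ.exists_measure_singleton_eq_natCast x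
  have hn0 : 0 < n := Nat.pos_of_ne_zero fun h => hx (by simp [hn, h])
  exact mem_iUnion.2 ⟨⟨n, hn0⟩, hxB, hn⟩

end PointMeasure

/-! ### The multiplicity counts of a configuration -/

section MultiplicityMeasure

variable {X : Type*} {B : Set X}

theorem multiplicityMeasure_singleton [Bornology X] [MeasurableSpace X]
    [MeasurableSingletonClass X] (hB : MeasurableSet B) (hb : Bornology.IsBounded B)
    (μ : PointMeasure X) (j : ℕ+) :
    (multiplicityMeasure hB hb μ).toMeasure {j} =
      (({x ∈ B | μ.toMeasure {x} = (j : ℕ)}.encard : ℕ∞) : ℝ≥0∞) := by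
  change (Measure.sum _) {j} = _
  rw [Measure.sum_smul_dirac_singleton]

/-- This trades a cardinality for a mass, through which finiteness and measurability of the counts
are obtained. -/
theorem PointMeasure.measure_multiplicity_eq [Bornology X] [MeasurableSpace X]
    [MeasurableSingletonClass X] (hB : MeasurableSet B) (hb : Bornology.IsBounded B)
    (μ : PointMeasure X) (j : ℕ+) :
    μ.toMeasure {x ∈ B | μ.toMeasure {x} = (j : ℕ)} =
      (j : ℕ) * (multiplicityMeasure hB hb μ).toMeasure {j} := by
  have hf := PointMeasure.finite_multiplicity hB hb μ j
  rw [multiplicityMeasure_singleton, hf.encard_eq_coe_toFinset_card]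
  conv_lhs => rw [← hf.coe_toFinset]
  rw [← sum_measure_singleton, Finset.sum_congr rfl fun x hx => (hf.mem_toFinset.1 hx).2]
  simp [mul_comm]

/-- The vacancy of `x` is essential: an occupied site would move from one multiplicity class to
another instead of creating a new one. -/
theorem multiplicityMeasure_addSingle [Bornology X] [MeasurableSpace X]
    [MeasurableSingletonClass X] (hB : MeasurableSet B) (hb : Bornology.IsBounded B)
    (μ : PointMeasure X) (j : ℕ+) {x : X} (hx : x ∈ B) (hμ : μ.toMeasure {x} = 0) :
    multiplicityMeasure hB hb (μ.addSingle x j) =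
      multiplicityMeasure hB hb μ + PointMeasure.single j := by
  classical
  refine Subtype.ext (Measure.ext_of_singleton fun k => ?_)
  change (multiplicityMeasure hB hb (μ.addSingle x j)).toMeasure {k} =
    (multiplicityMeasure hB hb μ + PointMeasure.single j).toMeasure {k}
  have key : ∀ y, (μ.addSingle x j).toMeasure {y} =
      if y = x then ((j : ℕ) : ℝ≥0∞) else μ.toMeasure {y} := by
    intro y
    rw [PointMeasure.toMeasure_addSingle]
    by_cases hy : y = x
    · simp [hy, hμ]
    · simp [hy, Ne.symm hy]
  have hk : ((k : ℕ) : ℝ≥0∞) ≠ 0 := by simp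
  rw [PointMeasure.toMeasure_add, Measure.add_apply, PointMeasure.toMeasure_single,
    multiplicityMeasure_singleton, multiplicityMeasure_singleton]
  by_cases hjk : j = k
  · subst hjk
    have hset : {y ∈ B | (μ.addSingle x j).toMeasure {y} = (j : ℕ)} =
        insert x {y ∈ B | μ.toMeasure {y} = (j : ℕ)} := by
      ext y
      by_cases hy : y = x
      · simp [hy, hx, key]
      · simp [hy, key]
    have hxn : x ∉ {y ∈ B | μ.toMeasure {y} = (j : ℕ)} := fun h => hk (h.2.symm.trans hμ)
    rw [hset, encard_insert_of_notMem hxn]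
    simp
  · have hset : {y ∈ B | (μ.addSingle x j).toMeasure {y} = (k : ℕ)} =
        {y ∈ B | μ.toMeasure {y} = (k : ℕ)} := by
      ext y
      by_cases hy : y = x
      · have h1 : ((j : ℕ) : ℝ≥0∞) ≠ (k : ℕ) := fun h =>
          hjk (PNat.eq (Nat.cast_injective (R := ℝ≥0∞) h))
        simp [hy, key, hμ, hjk, hk.symm]
      · simp [hy, key]
    rw [hset]
    simp [hjk]

theorem lintegral_pnat (μ : Measure ℕ+) (f : ℕ+ → ℝ≥0∞) :
    ∫⁻ j, f j ∂μ = ∑' j, f j * μ {j} :=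
  lintegral_countable' f

variable [MetricSpace X] [SecondCountableTopology X] [MeasurableSpace X] [BorelSpace X]

theorem isFiniteMeasure_multiplicityMeasure (hB : MeasurableSet B) (hb : Bornology.IsBounded B)
    (μ : PointMeasure X) : IsFiniteMeasure (multiplicityMeasure hB hb μ).toMeasure := by
  refine ⟨?_⟩
  have h1 : (multiplicityMeasure hB hb μ).toMeasure univ =
      ∑' j : ℕ+, (multiplicityMeasure hB hb μ).toMeasure {j} := by
    simpa using lintegral_pnat (multiplicityMeasure hB hb μ).toMeasure 1
  -- The classes of different multiplicities are disjoint in `B`, so the total count is at most `μ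
  -- B`.
  have hle : ∀ j : ℕ+, (multiplicityMeasure hB hb μ).toMeasure {j} ≤
      μ.toMeasure {x ∈ B | μ.toMeasure {x} = (j : ℕ)} := by
    intro j
    rw [PointMeasure.measure_multiplicity_eq hB hb]
    exact le_mul_of_one_le_left' (by exact_mod_cast (one_le : 1 ≤ j))
  rw [h1]
  refine (ENNReal.tsum_le_tsum hle).trans_lt ?_
  rw [← measure_iUnion]
  · exact (measure_mono (iUnion_subset fun j x hx => hx.1)).trans_lt (μ.measure_lt_top hB hb)
  · intro i j hij
    refine Set.disjoint_left.2 fun x hi hj => hij (PNat.eq ?_)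
    exact Nat.cast_injective (R := ℝ≥0∞) (hi.2.symm.trans hj.2)
  · exact fun j => PointMeasure.measurableSet_multiplicity hB μ _

theorem measurable_multiplicityMeasure (hB : MeasurableSet B) (hb : Bornology.IsBounded B) :
    Measurable (multiplicityMeasure hB hb) := by
  have hsingle : ∀ j : ℕ+,
      Measurable fun μ : PointMeasure X => (multiplicityMeasure hB hb μ).toMeasure {j} := by
    intro j
    have hS : MeasurableSet {p : PointMeasure X × X |
        p.2 ∈ B ∧ p.1.toMeasure {p.2} = ((j : ℕ) : ℝ≥0∞)} :=
      (measurable_snd hB).inter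
        ((PointMeasure.measurable_measure_singleton.comp measurable_swap)
          (measurableSet_singleton _))
    have hm : Measurable fun μ : PointMeasure X =>
        μ.toMeasure {x ∈ B | μ.toMeasure {x} = (j : ℕ)} :=
      Kernel.measurable_kernel_prodMk_left (κ := PointMeasure.kernel X) hS
    have heq : (fun μ : PointMeasure X => (multiplicityMeasure hB hb μ).toMeasure {j}) =
        fun μ => ((j : ℕ) : ℝ≥0∞)⁻¹ * μ.toMeasure {x ∈ B | μ.toMeasure {x} = (j : ℕ)} := by
      ext μ
      rw [PointMeasure.measure_multiplicity_eq hB hb, ← mul_assoc,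
        ENNReal.inv_mul_cancel (by simp) (by simp), one_mul]
    rw [heq]
    exact hm.const_mul _
  refine PointMeasure.measurable_of_measurable_coe fun A hA => ?_
  have heq : ∀ μ : PointMeasure X, (multiplicityMeasure hB hb μ).toMeasure A =
      ∑' j : ℕ+, A.indicator 1 j * (multiplicityMeasure hB hb μ).toMeasure {j} := by
    intro μ
    rw [← lintegral_pnat, lintegral_indicator_one hA]
  simp_rw [heq]
  exact Measurable.tsum fun j => (hsingle j).const_mul _

end MultiplicityMeasure

/-! ### The logarithmic intensity -/

section LogarithmicIntensity

theorem logarithmicIntensity_singleton (c : ℝ≥0∞) (t : ℝ) (j : ℕ+) :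
    logarithmicIntensity c t {j} = c * ENNReal.ofReal (t ^ (j : ℕ) / (j : ℕ)) := by
  rw [logarithmicIntensity, Measure.smul_apply, Measure.sum_smul_dirac_singleton, smul_eq_mul]

theorem isFiniteMeasure_logarithmicIntensity {c : ℝ≥0∞} (hc : c < ∞) {t : ℝ} (h0 : 0 ≤ t)
    (h1 : t < 1) : IsFiniteMeasure (logarithmicIntensity c t) := by
  refine ⟨?_⟩
  rw [logarithmicIntensity, Measure.smul_apply, smul_eq_mul, Measure.sum_apply _ .univ]
  refine ENNReal.mul_lt_top hc ?_
  simp only [Measure.smul_apply, measure_univ, smul_eq_mul, mul_one]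
  have hle : ∀ j : ℕ+, ENNReal.ofReal (t ^ (j : ℕ) / (j : ℕ)) ≤ ENNReal.ofReal t ^ (j : ℕ) := by
    intro j
    rw [← ENNReal.ofReal_pow h0]
    exact ENNReal.ofReal_le_ofReal
      (div_le_self (by positivity) (by exact_mod_cast (one_le : 1 ≤ j)))
  refine (ENNReal.tsum_le_tsum hle).trans_lt ?_
  refine (ENNReal.tsum_comp_le_tsum_of_injective PNat.coe_injective
    (fun n : ℕ => ENNReal.ofReal t ^ n)).trans_lt ?_
  rw [ENNReal.tsum_geometric]
  exact ENNReal.inv_lt_top.2 (tsub_pos_of_lt (by simpa using h1))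

end LogarithmicIntensity

/-! ### From the Pólya sum process to a Mecke equation for the counts -/

section PolyaSum

variable {X : Type*} [MetricSpace X] [SecondCountableTopology X] [MeasurableSpace X]
  [BorelSpace X] {ρ : Measure X} {z : ℝ} {Q : Measure (PointMeasure X)} {B : Set X}

/-- The pairs of a point in `B` and a configuration that has multiplicity `k` at this point. -/
def multiplicitySet (B : Set X) (k : ℕ) : Set (X × PointMeasure X) :=
  {p | p.1 ∈ B ∧ p.2.toMeasure {p.1} = k}

theorem measurableSet_multiplicitySet (hB : MeasurableSet B) (k : ℕ) :
    MeasurableSet (multiplicitySet B k) :=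
  (measurable_fst hB).inter (PointMeasure.measurable_measure_singleton (measurableSet_singleton _))

omit [SecondCountableTopology X] in
theorem mem_multiplicitySet_add_single {x : X} {μ : PointMeasure X} {k : ℕ} :
    (x, μ + PointMeasure.single x) ∈ multiplicitySet B (k + 1) ↔ (x, μ) ∈ multiplicitySet B k := by
  simp [multiplicitySet]

theorem IsPolyaSumProcess.lintegral_multiplicitySet_succ (hQ : IsPolyaSumProcess z ρ Q)
    (hB : MeasurableSet B) {H : X × PointMeasure X → ℝ≥0∞} (hH : Measurable H) (k : ℕ) :
    ∫⁻ μ, ∫⁻ x, (multiplicitySet B (k + 1)).indicator H (x, μ) ∂μ.toMeasure ∂Q =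
      ENNReal.ofReal z *
        (∫⁻ μ, ∫⁻ x, (multiplicitySet B k).indicator
            (fun p => H (p.1, p.2 + PointMeasure.single p.1)) (x, μ) ∂ρ ∂Q +
          ∫⁻ μ, ∫⁻ x, (multiplicitySet B k).indicator
            (fun p => H (p.1, p.2 + PointMeasure.single p.1)) (x, μ) ∂μ.toMeasure ∂Q) := by
  have hH' : Measurable ((multiplicitySet B k).indicator
      fun p => H (p.1, p.2 + PointMeasure.single p.1)) :=
    (hH.comp (measurable_fst.prodMk PointMeasure.measurable_add_single)).indicator
      (measurableSet_multiplicitySet hB k)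
  rw [hQ.campbell (fun x μ => (multiplicitySet B (k + 1)).indicator H (x, μ))
    (hH.indicator (measurableSet_multiplicitySet hB (k + 1)))]
  have heq : ∀ (x : X) (μ : PointMeasure X),
      (multiplicitySet B (k + 1)).indicator H (x, μ + PointMeasure.single x) =
        (multiplicitySet B k).indicator
          (fun p => H (p.1, p.2 + PointMeasure.single p.1)) (x, μ) := by
    intro x μ
    classical
    simp only [indicator_apply, mem_multiplicitySet_add_single]
  simp only [heq, lintegral_smul_measure, lintegral_add_measure, smul_eq_mul]
  rw [lintegral_const_mul' _ _ ENNReal.ofReal_ne_top, lintegral_add_right]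
  exact PointMeasure.measurable_lintegral (h := fun x μ => (multiplicitySet B k).indicator
    (fun p => H (p.1, p.2 + PointMeasure.single p.1)) (x, μ)) hH'

/-- The atoms of `μ` in `B` are countable, and a diffuse `ρ` does not charge a countable set. -/
theorem ae_measure_singleton_eq_zero [NullSingletonClass ρ] (hB : MeasurableSet B)
    (hb : Bornology.IsBounded B) (μ : PointMeasure X) :
    ∀ᵐ x ∂ρ, x ∈ B → μ.toMeasure {x} = 0 := by
  have h := (PointMeasure.countable_measure_singleton_ne_zero hB hb μ).measure_zero ρ
  filter_upwards [measure_eq_zero_iff_ae_notMem.1 h] with x hx hxB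
  by_contra h0
  exact hx ⟨hxB, h0⟩

theorem IsPolyaSumProcess.lintegral_multiplicitySet [NullSingletonClass ρ] (hQ : IsPolyaSumProcess z ρ Q)
    (hB : MeasurableSet B) (hb : Bornology.IsBounded B) (k : ℕ)
    {H : X × PointMeasure X → ℝ≥0∞} (hH : Measurable H) :
    ∫⁻ μ, ∫⁻ x, (multiplicitySet B (k + 1)).indicator H (x, μ) ∂μ.toMeasure ∂Q =
      ENNReal.ofReal z ^ (k + 1) *
        ∫⁻ μ, ∫⁻ x in B, H (x, μ.addSingle x (k + 1)) ∂ρ ∂Q := by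
  induction k generalizing H with
  | zero =>
    rw [hQ.lintegral_multiplicitySet_succ hB hH, zero_add, pow_one]
    -- At level 0 the reinforcement term vanishes, as `μ` has no mass off its atoms, and the
    -- `ρ`-term survives.
    have h1 : ∀ μ : PointMeasure X, ∫⁻ x, (multiplicitySet B 0).indicator
        (fun p => H (p.1, p.2 + PointMeasure.single p.1)) (x, μ) ∂μ.toMeasure = 0 := by
      intro μ
      refine lintegral_eq_zero_of_ae_eq_zero ?_
      filter_upwards [measure_eq_zero_iff_ae_notMem.1
        (PointMeasure.measure_multiplicity_zero hB hb μ)] with x hx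
      exact indicator_of_notMem (fun h => hx (by simpa [multiplicitySet] using h)) _
    have h2 : ∀ μ : PointMeasure X, ∫⁻ x, (multiplicitySet B 0).indicator
        (fun p => H (p.1, p.2 + PointMeasure.single p.1)) (x, μ) ∂ρ =
          ∫⁻ x in B, H (x, μ.addSingle x 1) ∂ρ := by
      intro μ
      rw [← lintegral_indicator hB]
      refine lintegral_congr_ae ?_
      filter_upwards [ae_measure_singleton_eq_zero hB hb μ] with x hx
      by_cases hxB : x ∈ B
      · rw [indicator_of_mem hxB, indicator_of_mem]
        · rfl
        · exact ⟨hxB, by simpa using hx hxB⟩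
      · rw [indicator_of_notMem hxB, indicator_of_notMem fun h => hxB h.1]
    simp [h1, h2]
  | succ k ih =>
    rw [hQ.lintegral_multiplicitySet_succ hB hH,
      ih (H := fun p => H (p.1, p.2 + PointMeasure.single p.1))
        (hH.comp (measurable_fst.prodMk PointMeasure.measurable_add_single))]
    -- At positive levels the roles are exchanged: `ρ` misses the atoms, and the `μ`-term is covered
    -- by the induction hypothesis for the shifted `H`.
    have h1 : ∀ μ : PointMeasure X, ∫⁻ x, (multiplicitySet B (k + 1)).indicator
        (fun p => H (p.1, p.2 + PointMeasure.single p.1)) (x, μ) ∂ρ = 0 := by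
      intro μ
      refine lintegral_eq_zero_of_ae_eq_zero ?_
      filter_upwards [ae_measure_singleton_eq_zero hB hb μ] with x hx
      refine indicator_of_notMem (fun h => ?_) _
      have h0 := h.2.symm.trans (hx h.1)
      exact absurd h0 (by exact_mod_cast k.succ_ne_zero)
    simp only [h1, lintegral_zero, zero_add]
    rw [← mul_assoc, ← pow_succ']
    have h2 : ∀ (x : X) (μ : PointMeasure X),
        μ.addSingle x (k + 1) + PointMeasure.single x = μ.addSingle x (k + 1 + 1) := fun x μ =>
      (Function.iterate_succ_apply' (fun ν => ν + PointMeasure.single x) (k + 1) μ).symm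
    simp only [h2]

/-- The Mecke equation for the multiplicity counts of a Pólya sum process. -/
theorem IsPolyaSumProcess.lintegral_mul_multiplicityMeasure [NullSingletonClass ρ]
    (hQ : IsPolyaSumProcess z ρ Q) (hz : 0 ≤ z) (hB : MeasurableSet B)
    (hb : Bornology.IsBounded B) (j : ℕ+) {G : PointMeasure ℕ+ → ℝ≥0∞} (hG : Measurable G) :
    ∫⁻ μ, G (multiplicityMeasure hB hb μ) * (multiplicityMeasure hB hb μ).toMeasure {j} ∂Q =
      logarithmicIntensity (ρ B) z {j} *
        ∫⁻ μ, G (multiplicityMeasure hB hb μ + PointMeasure.single j) ∂Q := by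
  obtain ⟨k, hk⟩ : ∃ k : ℕ, (j : ℕ) = k + 1 := ⟨(j : ℕ) - 1, (Nat.sub_add_cancel j.pos).symm⟩
  have hU := measurable_multiplicityMeasure hB hb
  have main := hQ.lintegral_multiplicitySet hB hb k
    (H := fun p => G (multiplicityMeasure hB hb p.2)) (hG.comp (hU.comp measurable_snd))
  rw [← hk] at main
  -- Each site of multiplicity `j` has mass `j`; this factor becomes the denominator of the
  -- logarithmic intensity.
  have h1 : ∀ μ : PointMeasure X, ∫⁻ x, (multiplicitySet B j).indicator
      (fun p => G (multiplicityMeasure hB hb p.2)) (x, μ) ∂μ.toMeasure =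
      (j : ℕ) * (G (multiplicityMeasure hB hb μ) *
        (multiplicityMeasure hB hb μ).toMeasure {j}) := by
    intro μ
    have h : (fun x => (multiplicitySet B j).indicator
        (fun p => G (multiplicityMeasure hB hb p.2)) (x, μ)) =
        {x ∈ B | μ.toMeasure {x} = (j : ℕ)}.indicator
          fun _ => G (multiplicityMeasure hB hb μ) := rfl
    rw [h, lintegral_indicator_const (PointMeasure.measurableSet_multiplicity hB μ _),
      PointMeasure.measure_multiplicity_eq hB hb]
    ring
  have h2 : ∀ μ : PointMeasure X,
      ∫⁻ x in B, G (multiplicityMeasure hB hb (μ.addSingle x j)) ∂ρ =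
        ρ B * G (multiplicityMeasure hB hb μ + PointMeasure.single j) := by
    intro μ
    rw [← lintegral_indicator hB, mul_comm, ← lintegral_indicator_const hB]
    refine lintegral_congr_ae ?_
    filter_upwards [ae_measure_singleton_eq_zero hB hb μ] with x hx
    by_cases hxB : x ∈ B
    · rw [indicator_of_mem hxB, indicator_of_mem hxB,
        multiplicityMeasure_addSingle hB hb μ j hxB (hx hxB)]
    · rw [indicator_of_notMem hxB, indicator_of_notMem hxB]
  have hadd : Measurable fun μ =>
      G (multiplicityMeasure hB hb μ + PointMeasure.single j) :=
    hG.comp ((PointMeasure.measurable_add_single.comp measurable_prodMk_left).comp hU)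
  simp only [h1, h2] at main
  rw [lintegral_const_mul' _ _ (by simp), lintegral_const_mul _ hadd] at main
  have hj : ((j : ℕ) : ℝ≥0∞) ≠ 0 := by simp
  rw [logarithmicIntensity_singleton, ENNReal.ofReal_div_of_pos (by exact_mod_cast j.pos),
    ENNReal.ofReal_pow hz, ENNReal.ofReal_natCast]
  rw [← ENNReal.mul_right_inj hj (by simp), main, div_eq_mul_inv]
  have hc := ENNReal.mul_inv_cancel hj (by simp)
  calc _ = ((j : ℕ) * ((j : ℕ) : ℝ≥0∞)⁻¹) * (ENNReal.ofReal z ^ (j : ℕ) *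
        (ρ B * ∫⁻ μ, G (multiplicityMeasure hB hb μ + PointMeasure.single j) ∂Q)) := by
        rw [hc, one_mul]
    _ = _ := by ring

theorem IsPolyaSumProcess.isPoissonProcess_multiplicityMeasure [NullSingletonClass ρ]
    (hQ : IsPolyaSumProcess z ρ Q) (hz : 0 ≤ z) (hB : MeasurableSet B)
    (hb : Bornology.IsBounded B) :
    IsPoissonProcess (logarithmicIntensity (ρ B) z) (Q.map (multiplicityMeasure hB hb)) := by
  have hU := measurable_multiplicityMeasure hB hb
  have := hQ.isProbabilityMeasure
  refine ⟨Measure.isProbabilityMeasure_map hU.aemeasurable, fun h hh => ?_⟩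
  have hj : ∀ j : ℕ+, Measurable (h j) := fun j => hh.comp measurable_prodMk_left
  have hadd : ∀ j : ℕ+, Measurable fun u => h j (u + PointMeasure.single j) := fun j =>
    (hj j).comp (PointMeasure.measurable_add_single.comp measurable_prodMk_left)
  have hmul : ∀ j : ℕ+, Measurable fun u : PointMeasure ℕ+ => h j u * u.toMeasure {j} :=
    fun j => (hj j).mul (PointMeasure.measurable_coe (measurableSet_singleton j))
  -- Integrals over the positive integers are series, so the Campbell identity reduces to one Mecke
  -- equation for each `j`.
  simp only [lintegral_pnat]
  rw [lintegral_tsum fun j => (hmul j).aemeasurable,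
    lintegral_tsum fun j => ((hadd j).mul_const _).aemeasurable]
  refine tsum_congr fun j => ?_
  rw [lintegral_mul_const _ (hadd j), lintegral_map (hmul j) hU, lintegral_map (hadd j) hU,
    hQ.lintegral_mul_multiplicityMeasure hz hB hb j (hj j), mul_comm]

end PolyaSum

/-! ### Poisson counts and independence from the Mecke equation -/

section Poisson

/-- A finite measure on `ℕ` satisfying the Stein recursion is a multiple of the Poisson
distribution. -/
theorem eq_smul_poissonMeasure {ν : Measure ℕ} {r : ℝ≥0}
    (h : ∀ n : ℕ, ((n + 1 : ℕ) : ℝ≥0∞) * ν {n + 1} = r * ν {n}) :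
    ν = ν univ • poissonMeasure r := by
  -- The constant is forced at `n = 0`, where the Poisson mass is `exp (-r)`; the recursion
  -- propagates it.
  have key : ν = (ENNReal.ofReal (Real.exp r) * ν {0}) • poissonMeasure r := by
    refine Measure.ext_of_singleton fun n => ?_
    rw [Measure.smul_apply, smul_eq_mul]
    induction n with
    | zero =>
      rw [poissonMeasure_singleton, mul_right_comm, ← ENNReal.ofReal_mul (Real.exp_pos _).le,
        pow_zero, mul_one, Nat.factorial_zero, Nat.cast_one, div_one, ← Real.exp_add]
      simp
    | succ n ih =>
      have hn : ((n + 1 : ℕ) : ℝ≥0∞) ≠ 0 := by simp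
      rw [← ENNReal.mul_right_inj hn (by simp), h, ih, mul_left_comm,
        mul_left_comm ((n + 1 : ℕ) : ℝ≥0∞)]
      congr 1
      rw [poissonMeasure_singleton, poissonMeasure_singleton, ← ENNReal.ofReal_natCast (n + 1),
        ← ENNReal.ofReal_coe_nnreal, ← ENNReal.ofReal_mul r.coe_nonneg,
        ← ENNReal.ofReal_mul (Nat.cast_nonneg _)]
      congr 1
      rw [Nat.factorial_succ]
      push_cast
      field_simp
      ring
  have huniv : ν univ = ENNReal.ofReal (Real.exp r) * ν {0} := by
    conv_lhs => rw [key]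
    simp
  rw [huniv]
  exact key

variable {ℓ : Measure ℕ+} {M : Measure (PointMeasure ℕ+)}

theorem PointMeasure.measurable_coe_singleton (j : ℕ+) :
    Measurable fun u : PointMeasure ℕ+ => u.toMeasure {j} :=
  measurable_coe (measurableSet_singleton j)

theorem IsPoissonProcess.lintegral_mul_coe_singleton (hM : IsPoissonProcess ℓ M) (j : ℕ+)
    {G : PointMeasure ℕ+ → ℝ≥0∞} (hG : Measurable G) :
    ∫⁻ u, G u * u.toMeasure {j} ∂M =
      ℓ {j} * ∫⁻ u, G (u + PointMeasure.single j) ∂M := by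
  classical
  have h := hM.campbell (fun i u => if i = j then G u else 0)
    (Measurable.ite (measurable_fst (measurableSet_singleton j)) (hG.comp measurable_snd)
      measurable_const)
  simp only [lintegral_pnat, ite_mul, zero_mul, tsum_ite_eq] at h
  have hadd : Measurable fun u => G (u + PointMeasure.single j) :=
    hG.comp (PointMeasure.measurable_add_single.comp measurable_prodMk_left)
  rw [h, lintegral_mul_const _ hadd, mul_comm]

/-- The number of points at `j`. -/
noncomputable def PointMeasure.count (j : ℕ+) (u : PointMeasure ℕ+) : ℕ :=
  ⌊(u.toMeasure {j}).toReal⌋₊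

theorem PointMeasure.natCast_count (j : ℕ+) (u : PointMeasure ℕ+) :
    (u.count j : ℝ≥0∞) = u.toMeasure {j} := by
  obtain ⟨n, hn⟩ := u.exists_measure_singleton_eq_natCast j
  simp [count, hn]

theorem PointMeasure.measurable_count (j : ℕ+) : Measurable (PointMeasure.count j) :=
  Nat.measurable_floor.comp (measurable_coe_singleton j).ennreal_toReal

theorem PointMeasure.count_add_single (j : ℕ+) (u : PointMeasure ℕ+) :
    (u + single j).count j = u.count j + 1 := by
  have h : (((u + single j).count j : ℕ) : ℝ≥0∞) = ((u.count j + 1 : ℕ) : ℝ≥0∞) := by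
    rw [natCast_count, Nat.cast_add, natCast_count]
    simp
  exact_mod_cast h

/-- On an event that does not depend on the points at `j`, the number of these points has a
Poisson distribution. -/
theorem IsPoissonProcess.map_restrict_coe_singleton (hM : IsPoissonProcess ℓ M) (j : ℕ+)
    (hj : ℓ {j} ≠ ∞) {A : Set (PointMeasure ℕ+)} (hA : MeasurableSet A)
    (hAj : ∀ u, u + PointMeasure.single j ∈ A ↔ u ∈ A) :
    (M.restrict A).map (fun u => u.toMeasure {j}) =
      M A • (poissonMeasure (ℓ {j}).toNNReal).map (fun n : ℕ => (n : ℝ≥0∞)) := by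
  have hc := PointMeasure.measurable_count j
  have hset : ∀ n, MeasurableSet (A ∩ PointMeasure.count j ⁻¹' {n}) := fun n =>
    hA.inter (hc (measurableSet_singleton n))
  have happ : ∀ n, (M.restrict A).map (PointMeasure.count j) {n} =
      M (A ∩ PointMeasure.count j ⁻¹' {n}) := by
    intro n
    rw [Measure.map_apply hc (measurableSet_singleton n),
      Measure.restrict_apply (hc (measurableSet_singleton n)), inter_comm]
  have key := eq_smul_poissonMeasure (ν := (M.restrict A).map (PointMeasure.count j))
    (r := (ℓ {j}).toNNReal) fun n => by
      rw [happ, happ, ENNReal.coe_toNNReal hj]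
      -- Testing against the event of `n + 1` points at `j` within `A` gives the recursion: a point
      -- added at `j` shifts the count by one and preserves `A`.
      have h := hM.lintegral_mul_coe_singleton j (measurable_one.indicator (hset (n + 1)))
      have h1 : ∀ u : PointMeasure ℕ+,
          (A ∩ PointMeasure.count j ⁻¹' {n + 1}).indicator 1 u * u.toMeasure {j} =
            (A ∩ PointMeasure.count j ⁻¹' {n + 1}).indicator
              (fun _ => ((n + 1 : ℕ) : ℝ≥0∞)) u := by
        intro u
        by_cases hu : u ∈ A ∩ PointMeasure.count j ⁻¹' {n + 1}
        · rw [indicator_of_mem hu, indicator_of_mem hu, ← PointMeasure.natCast_count,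
            show u.count j = n + 1 from hu.2, Pi.one_apply, one_mul]
        · rw [indicator_of_notMem hu, indicator_of_notMem hu, zero_mul]
      have h2 : ∀ u : PointMeasure ℕ+,
          (A ∩ PointMeasure.count j ⁻¹' {n + 1}).indicator (1 : PointMeasure ℕ+ → ℝ≥0∞)
              (u + PointMeasure.single j) =
            (A ∩ PointMeasure.count j ⁻¹' {n}).indicator 1 u := by
        intro u
        classical
        simp [indicator_apply, hAj, PointMeasure.count_add_single]
      simp only [h1, h2] at h
      rwa [lintegral_indicator_const (hset _), lintegral_indicator_one (hset _)] at h
  have hcomp : (fun u : PointMeasure ℕ+ => u.toMeasure {j}) =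
      (fun n : ℕ => (n : ℝ≥0∞)) ∘ PointMeasure.count j := by
    ext u
    exact (PointMeasure.natCast_count j u).symm
  rw [hcomp, ← Measure.map_map .of_discrete hc, key, Measure.map_smul,
    Measure.map_apply hc .univ, preimage_univ, Measure.restrict_apply_univ]

theorem IsPoissonProcess.map_coe_singleton (hM : IsPoissonProcess ℓ M) (j : ℕ+)
    (hj : ℓ {j} ≠ ∞) :
    M.map (fun u => u.toMeasure {j}) =
      (poissonMeasure (ℓ {j}).toNNReal).map (fun n : ℕ => (n : ℝ≥0∞)) := by
  have := hM.isProbabilityMeasure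
  simpa using hM.map_restrict_coe_singleton j hj .univ (by simp)

/-- An event about the counts at other integers is insensitive to points at `j`. Restricting to it
therefore only rescales the law of the count at `j`, and each induction step splits off one factor.
-/
theorem IsPoissonProcess.iIndepFun_coe_singleton (hM : IsPoissonProcess ℓ M)
    (hℓ : ∀ j, ℓ {j} ≠ ∞) :
    iIndepFun (fun (j : ℕ+) (u : PointMeasure ℕ+) => u.toMeasure {j}) M := by
  classical
  have := hM.isProbabilityMeasure
  rw [iIndepFun_iff_measure_inter_preimage_eq_mul]
  intro S s hs
  induction S using Finset.induction_on with
  | empty => simp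
  | insert j S hjS ih =>
    have hev := PointMeasure.measurable_coe_singleton
    have hsj := hs j (Finset.mem_insert_self j S)
    have hsS := fun i hi => hs i (Finset.mem_insert_of_mem hi)
    let A : Set (PointMeasure ℕ+) := ⋂ i ∈ S, (fun u => u.toMeasure {i}) ⁻¹' s i
    have hA : MeasurableSet A :=
      Finset.measurableSet_biInter S fun i hi => hev i (hsS i hi)
    have hAj : ∀ u, u + PointMeasure.single j ∈ A ↔ u ∈ A := by
      intro u
      simp only [A, mem_iInter, mem_preimage]
      refine forall₂_congr fun i hi => ?_
      have hij : j ≠ i := fun h => hjS (h ▸ hi)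
      simp [hij]
    have h1 := congrArg (fun m => m (s j)) (hM.map_restrict_coe_singleton j (hℓ j) hA hAj)
    simp only [← hM.map_coe_singleton j (hℓ j)] at h1
    rw [Measure.map_apply (hev j) hsj, Measure.restrict_apply (hev j hsj), Measure.smul_apply,
      Measure.map_apply (hev j) hsj, smul_eq_mul, ih hsS] at h1
    rw [Finset.set_biInter_insert, Finset.prod_insert hjS, mul_comm]
    exact h1

end Poisson

/-! ### The marginal law and the main theorem -/

/-- The configuration at time `t` is a Pólya sum process. -/
theorem IsSpatialRestaurantProcess.isPolyaSumProcess_map {X Ω : Type*} [MetricSpace X]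
    [MeasurableSpace X] [MeasurableSpace Ω] {P : Measure Ω} [IsProbabilityMeasure P]
    {ρ : Measure X} {Y : Ico (0 : ℝ) 1 → Ω → PointMeasure X}
    (hY : IsSpatialRestaurantProcess ρ P Y) (t : Ico (0 : ℝ) 1) :
    IsPolyaSumProcess t ρ (P.map (Y t)) := by
  -- The Markov property covers only `0 < t`. At `t = 0` the law is the point mass at the empty
  -- configuration and both sides of the Campbell identity are zero.
  rcases eq_or_lt_of_le (show (⟨0, by simp⟩ : Ico (0 : ℝ) 1) ≤ t from t.2.1) with h | h
  · subst h
    refine ⟨Measure.isProbabilityMeasure_map (hY.measurable _).aemeasurable, fun h hh => ?_⟩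
    have hzero : P.map (Y ⟨0, by simp⟩) = Measure.dirac 0 := by
      rw [Measure.map_congr hY.init]
      simp
    have h1 : ∀ᵐ μ ∂(Measure.dirac (0 : PointMeasure X)), ∫⁻ x, h x μ ∂μ.toMeasure = 0 := by
      rw [ae_iff]
      -- The exceptional set need not be measurable, so it is enclosed in the measurable event of
      -- positive total mass.
      refine measure_mono_null (t := {μ | μ.toMeasure univ ≠ 0}) ?_ ?_
      · intro μ hμ h0
        exact hμ (by simp [Measure.measure_univ_eq_zero.1 h0])
      · have hm : MeasurableSet {μ : PointMeasure X | μ.toMeasure univ ≠ 0} :=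
          ((PointMeasure.measurable_coe .univ) (measurableSet_singleton 0)).compl
        rw [Measure.dirac_apply' _ hm]
        simp
    rw [hzero, lintegral_eq_zero_of_ae_eq_zero h1]
    simp
  · obtain ⟨p, hp, hmarkov⟩ := hY.markov _ t h
    -- From the empty configuration at time 0 the parameters reduce to `(t - 0) / (1 - 0) = t` and
    -- `ρ + 0 = ρ`.
    obtain ⟨Q, hQ, hpQ⟩ := hp 0
    have hid : (fun μ : PointMeasure X => 0 + μ) = id := by
      funext μ
      ext A hA
      simp
    have hlaw : P.map (Y t) = Q := by
      ext C hC
      have h1 := hmarkov univ MeasurableSet.univ C hC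
      rw [univ_inter, Measure.restrict_univ] at h1
      have h2 : (fun ω => p (Y ⟨0, by simp⟩ ω) C) =ᵐ[P] fun _ => Q C := by
        filter_upwards [hY.init] with ω hω
        rw [hω, hpQ, hid, Measure.map_id]
      rw [Measure.map_apply (hY.measurable t) hC, h1, lintegral_congr_ae h2]
      simp
    rw [hlaw]
    simpa using hQ

theorem mainTheorem2 {X : Type*} [MetricSpace X] [PolishSpace X] [MeasurableSpace X] [BorelSpace X]
    {Ω : Type*} [MeasurableSpace Ω] (P : Measure Ω) [IsProbabilityMeasure P]
    (ρ : Measure X) (hρ : FiniteOnBounded ρ) (hdiffuse : ∀ x : X, ρ {x} = 0)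
    (Y : Ico (0 : ℝ) 1 → Ω → PointMeasure X) (hY : IsSpatialRestaurantProcess ρ P Y)
    (t : Ico (0 : ℝ) 1) (B : Set X) (hB : MeasurableSet B) (hb : Bornology.IsBounded B) :
    Measurable (fun ω => multiplicityMeasure hB hb (Y t ω)) ∧
    (∀ ω, IsFiniteMeasure (multiplicityMeasure hB hb (Y t ω)).toMeasure) ∧
    IsFiniteMeasure (logarithmicIntensity (ρ B) t) ∧
    IsPoissonProcess (logarithmicIntensity (ρ B) t)
      (P.map fun ω => multiplicityMeasure hB hb (Y t ω)) ∧
    (∀ j : ℕ+, HasLaw (fun ω => (multiplicityMeasure hB hb (Y t ω)).toMeasure {j})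
      ((poissonMeasure ((ρ B).toNNReal * Real.toNNReal ((t : ℝ) ^ (j : ℕ) / (j : ℕ)))).map
        (fun n : ℕ => (n : ℝ≥0∞))) P) ∧
    iIndepFun (fun (j : ℕ+) ω => (multiplicityMeasure hB hb (Y t ω)).toMeasure {j}) P := by
  have hQ := hY.isPolyaSumProcess_map t
  have hU := measurable_multiplicityMeasure hB hb
  have hUY : Measurable fun ω => multiplicityMeasure hB hb (Y t ω) := hU.comp (hY.measurable t)
  have : NullSingletonClass ρ := ⟨hdiffuse⟩
  have hR : IsPoissonProcess (logarithmicIntensity (ρ B) t)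
      (P.map fun ω => multiplicityMeasure hB hb (Y t ω)) := by
    have h := hQ.isPoissonProcess_multiplicityMeasure t.2.1 hB hb
    rwa [Measure.map_map hU (hY.measurable t)] at h
  have hfin := isFiniteMeasure_logarithmicIntensity (hρ B hB hb) t.2.1 t.2.2
  have hev := PointMeasure.measurable_coe_singleton
  refine ⟨hUY, fun ω => isFiniteMeasure_multiplicityMeasure hB hb _, hfin, hR, fun j => ?_, ?_⟩
  · refine ⟨((hev j).comp hUY).aemeasurable, ?_⟩
    have h := hR.map_coe_singleton j (measure_ne_top _ _)
    rw [Measure.map_map (hev j) hUY, logarithmicIntensity_singleton, ENNReal.toNNReal_mul] at h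
    exact h
  · have h := hR.iIndepFun_coe_singleton fun j => measure_ne_top _ _
    -- Independence under the image law is pulled back to `P` through the product formula on finite
    -- intersections.
    rw [iIndepFun_iff_measure_inter_preimage_eq_mul] at h ⊢
    intro S s hs
    have h1 := h S hs
    rw [Measure.map_apply hUY (Finset.measurableSet_biInter S fun i hi => hev i (hs i hi)),
      Finset.prod_congr rfl fun i hi => Measure.map_apply hUY (hev i (hs i hi))] at h1
    simp only [preimage_iInter] at h1
    exact h1
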